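/- Let $(R,\mathfrak m,k)$ be a commutative Noetherian local ring with $\mathfrak m^4=0$ and $\mathfrak m^3\neq 0$, and let $H_R(t)=\sum_{i\ge 0}\dim_k(\mathfrak m^i/\mathfrak m^{i+1})\,t^i$ be the Hilbert polynomial of its associated graded ring. Conventions. Let $M$ be a finitely generated $R$-module with minimal free resolution $F$. Its Betti numbers are $b_i=\operatorname{rank}F_i$. The resolution $F$ is \emph{eventually linear} if $H_i(\operatorname{gr}_{\mathfrak m}(F))=0$ for all $i\gg 0$, where $\operatorname{gr}_{\mathfrak m}(F)$ is the associated graded complex, with pieces $\mathfrak m^{p}F_{i+1}/\mathfrak m^{p+1}F_{i+1}\to\mathfrak m^{p+1}F_i/\mathfrak m^{p+2}F_i$ induced by the differential. The sequence $(b_i)$ has \emph{polynomial growth} if there are an integer $n\ge 0$, a real number $\alpha>0$ and real numbers $\lambda_i$ with $\lambda_i/i^n\to 0$ such that $\alpha i^n-\lambda_i\le b_i\le\alpha i^n+\lambda_i$ for all $i\gg 0$. It has \emph{exponential growth} if there are real numbers $a>1$, $\beta>0$ and $\rho_i$ with $\rho_i/a^i\to 0$ such that $\beta a^i-\rho_i\le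 b_i\le\beta a^i+\rho_i$ for all $i\gg 0$. Theorem. (1) Let $M$ and $N$ be finitely generated $R$-modules, each with an eventually linear minimal free resolution, and suppose that $\operatorname{Ext}^i_R(N,R)=0$ for all $i\gg 0$. If the Betti sequence of $M$ has polynomial growth and the Betti sequence of $N$ has exponential growth, then there is an integer $e\ge 0$ with \[ H_R(t)=1+et+et^2+t^3 . \] (2) In particular, the same conclusion holds if there is a totally reflexive $R$-module $M$ (that is, $M$ is finitely generated, the canonical map $M\to M^{**}$ is an isomorphism, and $\operatorname{Ext}^i_R(M,R)=0=\operatorname{Ext}^i_R(M^*,R)$ for all $i>0$, where $M^*=\operatorname{Hom}_R(M,R)$) such that the minimal free resolutions of $M$ and $M^*$ are eventually linear, the Betti sequence of $M$ has polynomial growth (for instance, is constant and nonzero) and the Betti sequence of $M^*$ has exponential growth. -/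

import Mathlib

open IsLocalRing Filter Topology

universe u v

/-- The graded piece `𝔪^p M / 𝔪^(p+1) M` of the associated graded module of `M` with respect to the
maximal ideal `𝔪` of `R`. It is written as `𝔪^p M` modulo `𝔪 • (𝔪^p M)`, so that it carries
Mathlib's structure of vector space over `R ⧸ 𝔪`. -/
abbrev GrPiece (R : Type u) [CommRing R] [IsLocalRing R] (M : Type v) [AddCommGroup M]
    [Module R M] (p : ℕ) : Type v :=
  ↥(maximalIdeal R ^ p • (⊤ : Submodule R M)) ⧸
    (maximalIdeal R • (⊤ : Submodule R ↥(maximalIdeal R ^ p • (⊤ : Submodule R M))))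

/-- The Hilbert series `∑ dim_k (𝔪^i / 𝔪^(i+1)) t^i` of the associated graded ring of the local
ring `R`, where `k = R ⧸ 𝔪`. -/
noncomputable def hilbertSeries (R : Type u) [CommRing R] [IsLocalRing R] : PowerSeries ℤ :=
  PowerSeries.mk fun i => (Module.finrank (R ⧸ maximalIdeal R) (GrPiece R R i) : ℤ)

/-- A minimal free resolution
`⋯ → R^(rank 2) → R^(rank 1) → R^(rank 0) → M → 0` of a (finitely generated) module over a
local ring. Minimality says that the image of each differential lies in `𝔪` times the next free
module. -/
structure MinimalFreeResolution (R : Type u) [CommRing R] [IsLocalRing R] (M : Type v)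
    [AddCommGroup M] [Module R M] where
  /-- The rank of the free module in degree `i`, that is, the `i`-th Betti number of `M`. -/
  rank : ℕ → ℕ
  /-- The differential from degree `i + 1` to degree `i`. -/
  d : ∀ i : ℕ, (Fin (rank (i + 1)) → R) →ₗ[R] (Fin (rank i) → R)
  /-- The augmentation. -/
  aug : (Fin (rank 0) → R) →ₗ[R] M
  aug_surjective : Function.Surjective aug
  exact_zero : Function.Exact (d 0) aug
  exact_succ : ∀ i : ℕ, Function.Exact (d (i + 1)) (d i)
  minimal : ∀ i : ℕ, LinearMap.range (d i) ≤
    maximalIdeal R • (⊤ : Submodule R (Fin (rank i) → R))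

namespace MinimalFreeResolution

variable {R : Type u} [CommRing R] [IsLocalRing R] {M : Type v} [AddCommGroup M] [Module R M]
  (F : MinimalFreeResolution R M)

theorem d_mem (i p : ℕ) :
    ∀ x ∈ maximalIdeal R ^ p • (⊤ : Submodule R (Fin (F.rank (i + 1)) → R)),
      F.d i x ∈ maximalIdeal R ^ (p + 1) • (⊤ : Submodule R (Fin (F.rank i) → R)) := by
  intro x hx
  have h : F.d i x ∈ Submodule.map (F.d i)
      (maximalIdeal R ^ p • (⊤ : Submodule R (Fin (F.rank (i + 1)) → R))) :=
    Submodule.mem_map_of_mem hx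
  rw [Submodule.map_smul'', Submodule.map_top] at h
  rw [pow_succ, mul_smul]
  exact Submodule.smul_mono le_rfl (F.minimal i) h

/-- The differential `𝔪^p F_(i+1) / 𝔪^(p+1) F_(i+1) → 𝔪^(p+1) F_i / 𝔪^(p+2) F_i` of the
associated graded complex `gr_𝔪(F)`, induced by restricting `d i`. -/
noncomputable def grD (i p : ℕ) :
    GrPiece R (Fin (F.rank (i + 1)) → R) p →ₗ[R] GrPiece R (Fin (F.rank i) → R) (p + 1) :=
  Submodule.mapQ _ _ ((F.d i).restrict (F.d_mem i p))
    (Submodule.smul_top_le_comap_smul_top _ _)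

/-- The associated graded complex `gr_𝔪(F)` is exact in homological degree `i + 1`. Its part in
degree `i + 1` is the direct sum of the pieces `𝔪^p F_(i+1) / 𝔪^(p+1) F_(i+1)`. Nothing maps to
the piece with `p = 0`, so there exactness is injectivity of the outgoing map. -/
def GrExactAtSucc (i : ℕ) : Prop :=
  Function.Injective (F.grD i 0) ∧
    ∀ p : ℕ, Function.Exact (F.grD (i + 1) p) (F.grD i (p + 1))

/-- The resolution is eventually linear: the homology of its associated graded complex vanishes
in all sufficiently high degrees (the linearity defect of `M` is finite). -/
def EventuallyLinear : Prop :=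
  ∃ n : ℕ, ∀ i ≥ n, F.GrExactAtSucc i

end MinimalFreeResolution

/-- Polynomial growth: `α i^n - l_i ≤ b_i ≤ α i^n + l_i` for all large `i`, with `α > 0` and
`l_i / i^n → 0`. -/
def HasPolynomialGrowth (b : ℕ → ℕ) : Prop :=
  ∃ (n : ℕ) (α : ℝ) (l : ℕ → ℝ), 0 < α ∧ Tendsto (fun i : ℕ => l i / (i : ℝ) ^ n) atTop (𝓝 0) ∧
    ∀ᶠ i : ℕ in atTop, α * (i : ℝ) ^ n - l i ≤ b i ∧ (b i : ℝ) ≤ α * (i : ℝ) ^ n + l i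

/-- Exponential growth of base `a > 1`: `β a^i - r_i ≤ b_i ≤ β a^i + r_i` for all large `i`, with
`β > 0` and `r_i / a^i → 0`. -/
def HasExponentialGrowthOfBase (a : ℝ) (b : ℕ → ℕ) : Prop :=
  1 < a ∧ ∃ (β : ℝ) (r : ℕ → ℝ), 0 < β ∧ Tendsto (fun i : ℕ => r i / a ^ i) atTop (𝓝 0) ∧
    ∀ᶠ i : ℕ in atTop, β * a ^ i - r i ≤ b i ∧ (b i : ℝ) ≤ β * a ^ i + r i

/-- Exponential growth, of some base. -/
def HasExponentialGrowth (b : ℕ → ℕ) : Prop :=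
  ∃ a : ℝ, HasExponentialGrowthOfBase a b

/-- `Ext_R^i(M, R) = 0`. -/
def ExtToRingVanishes (R : Type u) [CommRing R] (M : Type u) [AddCommGroup M] [Module R M]
    (i : ℕ) : Prop :=
  Subsingleton (CategoryTheory.Abelian.Ext (ModuleCat.of R M) (ModuleCat.of R R) i)

/-- A finitely generated module `M` is totally reflexive if it is reflexive and
`Ext_R^i(M, R) = 0 = Ext_R^i(M^*, R)` for all `i > 0`. -/
structure IsTotallyReflexive (R : Type u) [CommRing R] (M : Type u) [AddCommGroup M]
    [Module R M] : Prop where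
  finite : Module.Finite R M
  reflexive : Function.Bijective (Module.Dual.eval R M)
  ext_vanishes : ∀ i : ℕ, 0 < i → ExtToRingVanishes R M i
  ext_dual_vanishes : ∀ i : ℕ, 0 < i → ExtToRingVanishes R (Module.Dual R M) i

/-!
Let `e`, `f`, `s` be the dimensions of `𝔪/𝔪²`, `𝔪²/𝔪³`, `𝔪³`, let `c` and `b` be the Betti sequences
of `M` and `N`, and write `M_j`, `N_i` for syzygies. The point is to show `s = 1`; then `f = e`.

Eventual linearity makes `c` and `b` satisfy the recurrence with characteristic polynomial
`X³ - e X² + f X - s` (`MinimalFreeResolution.rank_recurrence`). Polynomial growth makes `1` a root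
and exponential growth of base `a` makes `a` a root, so `1 + f = e + s` and
`a² - (e - 1) a + s = 0`.

Everything else is a count of lengths of `Hom(N_i, R)` and `Hom(N_i, M_j)`, which are described as
cocycles of the complexes `Hom(G, R)` and `Hom(G, M_j)`, where `G` is the resolution of `N`. Since
`Ext^i(N, R) = 0` for large `i`, the dual of `G` is exact in high degrees. Hence
`len Hom(N_i, R) + len Hom(N_(i+1), R) = b_i len R`, and passing from `M_j` to `M_(j+1)` gives the
exact relation `Cocycles.len_relation` between the lengths of `Hom(N_i, M_j)` and
`Hom(N_(i+1), M_(j+1))`. Because `a > 1`, a Stolz–Cesàro argument along the diagonal shows that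
`len Hom(N_i, M_j)`, divided by `b_i` (the number of generators of `N_i`) and by the rank of the
free module in which `M_j` is a syzygy, tends to `h = (e + s) / (a + 1)`.

On the other hand `M_j` lies in a free module `F_j` and contains `𝔪³ F_j`, which lies in the socle,
so `Hom(N_i, M_j)` contains `Hom(N_i, 𝔪³ F_j)`, whose length gives `s ≤ h`. Equality is impossible:
almost all of `Hom(N_i, M_j)` would then be killed by `𝔪`, so that `𝔪 Hom(N_i, F_(j+1))` would
almost be contained in `Hom(N_i, M_(j+1))`, although `Hom(N_i, R)` has too few generators for this
(`Cocycles.exists_len_eq`). So `s < h`, that is `s a < e`. If `s ≥ 2`, this puts the integer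
`e - 1 = a + s / a` strictly between `s` and `s + 1` (`eq_one_of_mul_lt`), a contradiction.
-/

/-! ### Lengths of finite modules over an Artinian ring -/

/-- The length of a module as a natural number; it is the junk value `0` for modules of infinite
length, which do not occur among the finite modules over an Artinian ring. -/
noncomputable def len (R : Type*) [CommRing R] (M : Type*) [AddCommGroup M] [Module R M] : ℕ :=
  (Module.length R M).toNat

section Length

variable {R : Type*} [CommRing R]
  {A B C : Type*} [AddCommGroup A] [Module R A] [AddCommGroup B] [Module R B]
  [AddCommGroup C] [Module R C]

theorem LinearEquiv.len_eq (e : A ≃ₗ[R] B) : len R A = len R B := by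
  rw [len, len, e.length_eq]

theorem len_eq_zero_of_subsingleton [Subsingleton A] : len R A = 0 := by
  simp [len, Module.length_eq_zero]

variable (R) in
theorem len_pi (n : ℕ) : len R (Fin n → A) = n * len R A := by
  simp [len]

variable (R) in
theorem len_hom (n : ℕ) : len R ((Fin n → R) →ₗ[R] A) = n * len R A := by
  rw [← len_pi, ((Pi.basisFun R (Fin n)).constr R).symm.len_eq]

variable [IsArtinianRing R]

variable (R A) in
theorem coe_len [Module.Finite R A] : (len R A : ℕ∞) = Module.length R A :=
  ENat.natCast_toNat Module.length_ne_top

theorem len_add_of_exact [Module.Finite R A] [Module.Finite R B] [Module.Finite R C]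
    {f : A →ₗ[R] B} {g : B →ₗ[R] C} (hf : Function.Injective f) (hg : Function.Surjective g)
    (h : Function.Exact f g) : len R B = len R A + len R C := by
  have := Module.length_eq_add_of_exact f g hf hg h
  rw [← coe_len, ← coe_len, ← coe_len] at this
  exact_mod_cast this

theorem len_le_of_injective [Module.Finite R A] [Module.Finite R B] {f : A →ₗ[R] B}
    (hf : Function.Injective f) : len R A ≤ len R B := by
  have := Module.length_le_of_injective f hf
  rw [← coe_len, ← coe_len] at this
  exact_mod_cast this

theorem len_le_of_surjective [Module.Finite R A] [Module.Finite R B] {f : A →ₗ[R] B}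
    (hf : Function.Surjective f) : len R B ≤ len R A := by
  have := Module.length_le_of_surjective f hf
  rw [← coe_len, ← coe_len] at this
  exact_mod_cast this

theorem len_mono [Module.Finite R A] {S T : Submodule R A} (h : S ≤ T) : len R S ≤ len R T :=
  len_le_of_injective (Submodule.inclusion_injective h)

theorem len_ker_add_len_range [Module.Finite R A] [Module.Finite R B] (f : A →ₗ[R] B) :
    len R (LinearMap.ker f) + len R (LinearMap.range f) = len R A :=
  (len_add_of_exact (Submodule.subtype_injective _) f.surjective_rangeRestrict
    (by rw [LinearMap.exact_iff]; simp)).symm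

theorem len_add_of_exact_of_exact [Module.Finite R A] [Module.Finite R B] [Module.Finite R C]
    {D : Type*} [AddCommGroup D] [Module R D] [Module.Finite R D]
    {f : A →ₗ[R] B} {g : B →ₗ[R] C} {h : C →ₗ[R] D} (hf : Function.Injective f)
    (hfg : Function.Exact f g) (hgh : Function.Exact g h) (hh : Function.Surjective h) :
    len R A + len R C = len R B + len R D := by
  have h1 := len_ker_add_len_range g
  have h2 := len_ker_add_len_range h
  rw [hfg.linearMap_ker_eq, ← (LinearEquiv.ofInjective f hf).len_eq] at h1
  rw [hgh.linearMap_ker_eq, LinearMap.range_eq_top.2 hh, Submodule.topEquiv.len_eq] at h2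
  omega

theorem len_add_len_quotient [Module.Finite R A] (S : Submodule R A) :
    len R S + len R (A ⧸ S) = len R A :=
  (len_add_of_exact S.subtype_injective S.mkQ_surjective (LinearMap.exact_subtype_mkQ S)).symm

theorem len_inf_ker_add_len_map [Module.Finite R A] [Module.Finite R B] (f : A →ₗ[R] B)
    (S : Submodule R A) :
    len R ↥(S ⊓ LinearMap.ker f) + len R (S.map f) = len R S := by
  rw [← len_ker_add_len_range (f.domRestrict S), LinearMap.range_domRestrict]
  congr 1
  rw [LinearMap.ker_domRestrict, ← Submodule.map_comap_subtype]
  exact ((Submodule.equivMapOfInjective _ S.subtype_injective _).symm).len_eq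

theorem len_sup_le [Module.Finite R A] (S T : Submodule R A) :
    len R ↥(S ⊔ T) ≤ len R S + len R T := by
  rw [← len_inf_ker_add_len_map T.mkQ (S ⊔ T), Submodule.ker_mkQ, Submodule.map_sup,
    Submodule.mkQ_map_self, sup_bot_eq, ← len_inf_ker_add_len_map T.mkQ S,
    inf_eq_right.2 le_sup_right]
  omega

theorem len_iSup_le [Module.Finite R A] {ι : Type*} [Fintype ι] (S : ι → Submodule R A) (n : ℕ)
    (h : ∀ i, len R (S i) ≤ n) : len R ↥(⨆ i, S i) ≤ Fintype.card ι * n := by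
  classical
  have key : ∀ s : Finset ι, len R ↥(s.sup S) ≤ s.card * n := by
    intro s
    induction s using Finset.induction_on with
    | empty =>
      rw [Finset.sup_empty, len_eq_zero_of_subsingleton]
      exact Nat.zero_le _
    | insert a s ha ih =>
      rw [Finset.sup_insert, Finset.card_insert_of_notMem ha]
      have := len_sup_le (S a) (s.sup S)
      have := h a
      linarith
  rw [← Finset.sup_univ_eq_iSup]
  exact key Finset.univ

/-- If `I` kills a submodule `S` of `A`, then each generator of `I` maps `A` onto a quotient of
`A ⧸ S`, which bounds the length of `I • A`. -/
theorem len_span_smul_top_le [Module.Finite R A] (s : Finset R) (S : Submodule R A)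
    (hS : Ideal.span (s : Set R) • S = ⊥) :
    len R ↥(Ideal.span (s : Set R) • (⊤ : Submodule R A)) ≤ s.card * len R (A ⧸ S) := by
  have hle : Ideal.span (s : Set R) • (⊤ : Submodule R A) ≤
      ⨆ i : s, LinearMap.range (LinearMap.lsmul R A i) := by
    refine Submodule.smul_le.2 fun r hr x _ => ?_
    induction hr using Submodule.span_induction with
    | mem r hr => exact Submodule.mem_iSup_of_mem ⟨r, hr⟩ ⟨x, rfl⟩
    | zero => simp
    | add r r' _ _ h h' => rw [add_smul]; exact add_mem h h'
    | smul t r _ h => rw [smul_assoc]; exact Submodule.smul_mem _ _ h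
  refine (len_mono hle).trans ?_
  rw [← Fintype.card_coe s]
  refine len_iSup_le _ _ fun i => ?_
  have hker : S ≤ LinearMap.ker (LinearMap.lsmul R A i) := by
    intro x hx
    have : (i : R) • x ∈ Ideal.span (s : Set R) • S :=
      Submodule.smul_mem_smul (Ideal.subset_span i.2) hx
    rw [hS] at this
    simpa using this
  refine len_le_of_surjective
    (f := (S.liftQ _ hker).codRestrict (LinearMap.range (LinearMap.lsmul R A i)) ?_) ?_
  · rintro ⟨x⟩
    exact ⟨x, rfl⟩
  · rintro ⟨_, x, rfl⟩
    exact ⟨S.mkQ x, rfl⟩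

end Length

/-! ### Vanishing of `Ext` and extension of homomorphisms -/

section Ext

open CategoryTheory

variable {R : Type u} [CommRing R] {K P N : Type u} [AddCommGroup K] [Module R K]
  [AddCommGroup P] [Module R P] [AddCommGroup N] [Module R N]

/-- The short complex `K → P → N` of modules. -/
abbrev shortComplexOfExact (f : K →ₗ[R] P) (g : P →ₗ[R] N) (h : Function.Exact f g) :
    ShortComplex (ModuleCat.{u} R) :=
  ShortComplex.mk (ModuleCat.ofHom f) (ModuleCat.ofHom g) (by
    ext x
    exact h.apply_apply_eq_zero x)

theorem shortExact_shortComplexOfExact {f : K →ₗ[R] P} {g : P →ₗ[R] N} (hf : Function.Injective f)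
    (hg : Function.Surjective g) (h : Function.Exact f g) :
    (shortComplexOfExact f g h).ShortExact where
  exact := (ShortComplex.ShortExact.moduleCat_exact_iff_function_exact _).2 h
  mono_f := (ModuleCat.mono_iff_injective _).2 hf
  epi_g := (ModuleCat.epi_iff_surjective _).2 hg

variable {f : K →ₗ[R] P} {g : P →ₗ[R] N}

/-- Dimension shifting along an exact sequence `0 → K → P → N → 0` with `P` projective. -/
theorem ExtToRingVanishes.syzygy [Module.Projective R P] (hf : Function.Injective f)
    (hg : Function.Surjective g) (h : Function.Exact f g) {k : ℕ}
    (hN : ExtToRingVanishes R N (k + 2)) : ExtToRingVanishes R K (k + 1) := by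
  have hS := shortExact_shortComplexOfExact hf hg h
  have : Projective (ModuleCat.of R P) := (IsProjective.iff_projective P).1 inferInstance
  refine subsingleton_of_forall_eq 0 fun x => ?_
  obtain ⟨y, hy⟩ := Abelian.Ext.contravariant_sequence_exact₁ hS _ x
    (show 1 + (k + 1) = k + 2 by omega) (hN.elim _ _)
  rw [← hy, Abelian.Ext.eq_zero_of_projective (P := ModuleCat.of R P) y]
  simp

/-- If `0 → K → P → N → 0` is exact and `Ext¹(N, R) = 0`, then homomorphisms `K → R` extend to
`P`. -/
theorem ExtToRingVanishes.exists_extension (hf : Function.Injective f)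
    (hg : Function.Surjective g) (h : Function.Exact f g)
    (hN : ExtToRingVanishes R N 1) (φ : K →ₗ[R] R) : ∃ ψ : P →ₗ[R] R, ψ ∘ₗ f = φ := by
  have hS := shortExact_shortComplexOfExact hf hg h
  obtain ⟨y, hy⟩ := Abelian.Ext.contravariant_sequence_exact₁ hS _
    (Abelian.Ext.mk₀ (ModuleCat.ofHom φ)) (add_zero 1) (hN.elim _ _)
  obtain ⟨ψ, rfl⟩ := Abelian.Ext.mk₀_bijective _ _ |>.2 y
  refine ⟨ψ.hom, ?_⟩
  rw [Abelian.Ext.mk₀_comp_mk₀] at hy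
  have := (Abelian.Ext.mk₀_bijective _ _).1 hy
  exact congrArg ModuleCat.Hom.hom this

end Ext

namespace MinimalFreeResolution

section

variable {R : Type u} [CommRing R] [IsLocalRing R] {N : Type u} [AddCommGroup N] [Module R N]
  (G : MinimalFreeResolution R N)

theorem extToRingVanishes_range (l m : ℕ) (h : ExtToRingVanishes R N (m + l + 2)) :
    ExtToRingVanishes R (LinearMap.range (G.d l)) (m + 1) := by
  induction l generalizing m with
  | zero =>
    refine h.syzygy (Submodule.subtype_injective _) G.aug_surjective ?_
    rw [LinearMap.exact_iff, Submodule.range_subtype, G.exact_zero.linearMap_ker_eq]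
  | succ l ih =>
    have := ih (m + 1) (by convert h using 1; omega)
    refine this.syzygy (g := (G.d l).rangeRestrict) (Submodule.subtype_injective _)
      (LinearMap.surjective_rangeRestrict _) ?_
    rw [LinearMap.exact_iff, Submodule.range_subtype, LinearMap.ker_rangeRestrict,
      (G.exact_succ l).linearMap_ker_eq]

/-- If `Ext^(i+1)(N, R) = 0`, then the dual of the resolution is exact in degree `i + 1`. -/
theorem exists_comp_d_eq {i : ℕ} (h : ExtToRingVanishes R N (i + 1))
    (φ : (Fin (G.rank (i + 1)) → R) →ₗ[R] R) (hφ : φ ∘ₗ G.d (i + 1) = 0) :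
    ∃ ψ : (Fin (G.rank i) → R) →ₗ[R] R, ψ ∘ₗ G.d i = φ := by
  have hker : LinearMap.ker (G.d i).rangeRestrict ≤ LinearMap.ker φ := by
    rw [LinearMap.ker_rangeRestrict, (G.exact_succ i).linearMap_ker_eq]
    exact LinearMap.range_le_ker_iff.2 hφ
  -- `φ` factors through the image of `d i`
  obtain ⟨φ', hφ'⟩ : ∃ φ' : LinearMap.range (G.d i) →ₗ[R] R, φ' ∘ₗ (G.d i).rangeRestrict = φ := by
    refine ⟨(LinearMap.ker (G.d i)).liftQ φ (by simpa using hker) ∘ₗ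
      (G.d i).quotKerEquivRange.symm.toLinearMap, LinearMap.ext fun x => ?_⟩
    have := (G.d i).quotKerEquivRange_symm_apply_image x ⟨x, rfl⟩
    simp [LinearMap.rangeRestrict, LinearMap.codRestrict, this]
  obtain ⟨ψ, hψ⟩ : ∃ ψ : (Fin (G.rank i) → R) →ₗ[R] R,
      ψ ∘ₗ (LinearMap.range (G.d i)).subtype = φ' := by
    cases i with
    | zero =>
      refine h.exists_extension (Submodule.subtype_injective _) G.aug_surjective ?_ φ'
      rw [LinearMap.exact_iff, Submodule.range_subtype, G.exact_zero.linearMap_ker_eq]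
    | succ l =>
      refine (G.extToRingVanishes_range l 0 (by convert h using 1; omega)).exists_extension
        (g := (G.d l).rangeRestrict) (Submodule.subtype_injective _)
        (LinearMap.surjective_rangeRestrict _) ?_ φ'
      rw [LinearMap.exact_iff, Submodule.range_subtype, LinearMap.ker_rangeRestrict,
        (G.exact_succ l).linearMap_ker_eq]
  refine ⟨ψ, ?_⟩
  rw [← hφ', ← hψ]
  rfl

end

end MinimalFreeResolution

/-! ### Lengths of modules of cocycles -/

section Cocycles

variable {R : Type*} [CommRing R]
  {P Q S : Type*} [AddCommGroup P] [Module R P] [AddCommGroup Q] [Module R Q]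
  [AddCommGroup S] [Module R S]
  {A B C : Type*} [AddCommGroup A] [Module R A] [AddCommGroup B] [Module R B]
  [AddCommGroup C] [Module R C]

/-- The module of homomorphisms `P → A` that vanish on the image of `d : Q → P`; these are the
homomorphisms `coker d → A`. It is a type of its own, with a single additive group structure, rather
than a submodule of `P →ₗ[R] A` coerced to a type. -/
def Cocycles (d : Q →ₗ[R] P) (A : Type*) [AddCommGroup A] [Module R A] : Type _ :=
  LinearMap.ker (d.lcomp R A)

instance (d : Q →ₗ[R] P) : AddCommGroup (Cocycles d A) :=
  inferInstanceAs (AddCommGroup (LinearMap.ker (d.lcomp R A)))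

instance (d : Q →ₗ[R] P) : Module R (Cocycles d A) :=
  inferInstanceAs (Module R (LinearMap.ker (d.lcomp R A)))

instance [IsNoetherianRing R] [Module.Finite R P] [Module.Free R P] [Module.Finite R A]
    (d : Q →ₗ[R] P) : Module.Finite R (Cocycles d A) :=
  inferInstanceAs (Module.Finite R (LinearMap.ker (d.lcomp R A)))

namespace Cocycles

/-- The inclusion of the cocycles in all homomorphisms. -/
def toHom (d : Q →ₗ[R] P) (A : Type*) [AddCommGroup A] [Module R A] :
    Cocycles d A →ₗ[R] (P →ₗ[R] A) :=
  (LinearMap.ker (d.lcomp R A)).subtype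

theorem toHom_injective (d : Q →ₗ[R] P) : Function.Injective (toHom d A) :=
  Submodule.subtype_injective _

@[ext]
theorem ext {d : Q →ₗ[R] P} {φ ψ : Cocycles d A} (h : ∀ x, toHom d A φ x = toHom d A ψ x) :
    φ = ψ :=
  toHom_injective d (LinearMap.ext h)

@[simp]
theorem toHom_apply_apply {d : Q →ₗ[R] P} (φ : Cocycles d A) (x : Q) : toHom d A φ (d x) = 0 :=
  LinearMap.congr_fun (show toHom d A φ ∘ₗ d = 0 from φ.2) x

/-- A homomorphism that vanishes on the image of `d`, as a cocycle. -/
def mk {d : Q →ₗ[R] P} (φ : P →ₗ[R] A) (h : φ ∘ₗ d = 0) : Cocycles d A :=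
  ⟨φ, h⟩

@[simp]
theorem toHom_mk {d : Q →ₗ[R] P} (φ : P →ₗ[R] A) (h : φ ∘ₗ d = 0) : toHom d A (mk φ h) = φ := rfl

/-- Composition with `f : A → B`, as a map on cocycles. -/
def map (d : Q →ₗ[R] P) (f : A →ₗ[R] B) : Cocycles d A →ₗ[R] Cocycles d B where
  toFun φ := mk (f ∘ₗ toHom d A φ) (LinearMap.ext fun x => by simp)
  map_add' φ ψ := ext fun x => by simp
  map_smul' r φ := ext fun x => by simp

/-- Composition with `d : Q → P`, as a map to the cocycles of `d' : S → Q`. -/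
def coboundary (d : Q →ₗ[R] P) (d' : S →ₗ[R] Q) (h : d ∘ₗ d' = 0) (A : Type*) [AddCommGroup A]
    [Module R A] : (P →ₗ[R] A) →ₗ[R] Cocycles d' A where
  toFun φ := mk (φ ∘ₗ d) (by rw [LinearMap.comp_assoc, h, LinearMap.comp_zero])
  map_add' φ ψ := ext fun x => by simp
  map_smul' r φ := ext fun x => by simp

@[simp]
theorem toHom_coboundary (d : Q →ₗ[R] P) (d' : S →ₗ[R] Q) (h : d ∘ₗ d' = 0) (φ : P →ₗ[R] A) :
    toHom d' A (coboundary d d' h A φ) = φ ∘ₗ d := rfl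

theorem exact_toHom_coboundary (d : Q →ₗ[R] P) (d' : S →ₗ[R] Q) (h : d ∘ₗ d' = 0) :
    Function.Exact (toHom d A) (coboundary d d' h A) := fun φ =>
  ⟨fun hφ => ⟨mk φ (congrArg (toHom d' A) hφ), rfl⟩, by
    rintro ⟨ψ, rfl⟩
    exact ext fun x => by simp⟩

theorem map_injective (d : Q →ₗ[R] P) {f : A →ₗ[R] B} (hf : Function.Injective f) :
    Function.Injective (map d f) := fun _ _ h =>
  ext fun x => hf (LinearMap.congr_fun (congrArg (toHom d B) h) x)

theorem map_exact (d : Q →ₗ[R] P) {f : A →ₗ[R] B} {g : B →ₗ[R] C}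
    (hf : Function.Injective f) (h : Function.Exact f g) :
    Function.Exact (map d f) (map d g) := by
  intro φ
  constructor
  · intro hφ
    have hφ' : ∀ x, toHom d B φ x ∈ LinearMap.range f := fun x =>
      (h _).1 (LinearMap.congr_fun (congrArg (toHom d C) hφ) x)
    let e := LinearEquiv.ofInjective f hf
    have he : ∀ x, f (e.symm ⟨toHom d B φ x, hφ' x⟩) = toHom d B φ x := fun x =>
      congrArg Subtype.val (e.apply_symm_apply ⟨toHom d B φ x, hφ' x⟩)
    refine ⟨mk (e.symm.toLinearMap ∘ₗ (toHom d B φ).codRestrict _ hφ') ?_, ext fun x => he x⟩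
    ext x
    refine hf ((he (d x)).trans ?_)
    simp
  · rintro ⟨ψ, rfl⟩
    exact ext fun x => h.apply_apply_eq_zero _

/-- Cocycles with values in `Rⁿ` are tuples of cocycles. -/
def piEquiv (d : Q →ₗ[R] P) (n : ℕ) : Cocycles d (Fin n → R) ≃ₗ[R] (Fin n → Cocycles d R) where
  toFun φ i := map d (LinearMap.proj i) φ
  map_add' _ _ := rfl
  map_smul' _ _ := rfl
  invFun φ := mk (LinearMap.pi fun i => toHom d R (φ i))
    (LinearMap.ext fun x => funext fun i => by simp)
  left_inv _ := rfl
  right_inv _ := rfl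

theorem coboundary_surjective {d : Q →ₗ[R] P} {d' : S →ₗ[R] Q} (h : d ∘ₗ d' = 0)
    (hex : ∀ φ : Q →ₗ[R] R, φ ∘ₗ d' = 0 → ∃ ψ : P →ₗ[R] R, ψ ∘ₗ d = φ) :
    Function.Surjective (coboundary d d' h R) := fun φ => by
  obtain ⟨ψ, hψ⟩ := hex (toHom d' R φ) (LinearMap.ext fun x => by simp)
  exact ⟨ψ, toHom_injective _ hψ⟩

theorem coboundary_pi_surjective {d : Q →ₗ[R] P} {d' : S →ₗ[R] Q} (h : d ∘ₗ d' = 0)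
    (hex : ∀ φ : Q →ₗ[R] R, φ ∘ₗ d' = 0 → ∃ ψ : P →ₗ[R] R, ψ ∘ₗ d = φ) (n : ℕ) :
    Function.Surjective (coboundary d d' h (Fin n → R)) := fun φ => by
  choose ψ hψ using fun i => coboundary_surjective h hex (piEquiv d' n φ i)
  refine ⟨LinearMap.pi ψ, (piEquiv d' n).injective (funext fun i => ?_)⟩
  rw [← hψ]
  rfl

variable [IsArtinianRing R] {p q n : ℕ}
  {d : (Fin q → R) →ₗ[R] (Fin p → R)} {d' : S →ₗ[R] (Fin q → R)}

theorem len_add_len (h : d ∘ₗ d' = 0)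
    (hex : ∀ φ : (Fin q → R) →ₗ[R] R, φ ∘ₗ d' = 0 → ∃ ψ : (Fin p → R) →ₗ[R] R, ψ ∘ₗ d = φ) :
    len R (Cocycles d R) + len R (Cocycles d' R) = p * len R R := by
  rw [← len_hom]
  exact (len_add_of_exact (toHom_injective d) (coboundary_surjective h hex)
    (exact_toHom_coboundary d d' h)).symm

/-- If `0 → A → Rⁿ → C → 0` is exact and the dual of `S → Rᑫ → Rᵖ` is exact, then the image of
the cocycles with values in `Rⁿ` consists of the coboundaries with values in `C`. Counting these in
two ways relates the lengths of the cocycles with values in `A` and in `C`. -/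
theorem len_relation (h : d ∘ₗ d' = 0)
    (hex : ∀ φ : (Fin q → R) →ₗ[R] R, φ ∘ₗ d' = 0 → ∃ ψ : (Fin p → R) →ₗ[R] R, ψ ∘ₗ d = φ)
    [Module.Finite R A] [Module.Finite R C] {f : A →ₗ[R] (Fin n → R)} {g : (Fin n → R) →ₗ[R] C}
    (hf : Function.Injective f) (hg : Function.Surjective g) (hfg : Function.Exact f g) :
    len R (Cocycles d' A) + p * len R C = len R (Cocycles d C) + n * len R (Cocycles d' R) := by
  -- one inclusion lifts a cocycle with values in `Rⁿ` by exactness, the other lifts along `g`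
  have hrange : LinearMap.range (map d' g) = LinearMap.range (coboundary d d' h C) := by
    apply le_antisymm
    · rintro _ ⟨φ, rfl⟩
      obtain ⟨ψ, rfl⟩ := coboundary_pi_surjective h hex n φ
      exact ⟨g ∘ₗ ψ, rfl⟩
    · rintro _ ⟨φ, rfl⟩
      obtain ⟨ψ, rfl⟩ := Module.projective_lifting_property g φ hg
      exact ⟨coboundary d d' h _ ψ, rfl⟩
  have h1 := len_ker_add_len_range (map d' g)
  have h2 := len_ker_add_len_range (coboundary d d' h C)
  have h3 := (LinearEquiv.ofInjective _ (map_injective d' hf)).len_eq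
  have h4 := (LinearEquiv.ofInjective _ (toHom_injective (A := C) d)).len_eq
  have h5 := (piEquiv d' n).len_eq
  rw [(map_exact d' hf hfg).linearMap_ker_eq, hrange] at h1
  rw [(exact_toHom_coboundary d d' h).linearMap_ker_eq, len_hom] at h2
  rw [len_pi] at h5
  omega

end Cocycles

end Cocycles

section Quotient

variable {R : Type*} [CommRing R] {A : Type*} [AddCommGroup A] [Module R A]

theorem smul_top_pi (I : Ideal R) (n : ℕ) :
    I • (⊤ : Submodule R (Fin n → A)) = Submodule.pi Set.univ fun _ => I • (⊤ : Submodule R A) := by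
  apply le_antisymm
  · rw [Submodule.smul_le]
    exact fun r hr x _ i _ => Submodule.smul_mem_smul hr trivial
  · intro x hx
    rw [← Finset.univ_sum_single x]
    refine sum_mem fun i _ => ?_
    have : LinearMap.single R (fun _ => A) i (x i) ∈
        (I • (⊤ : Submodule R A)).map (LinearMap.single R (fun _ => A) i) :=
      ⟨_, hx i trivial, rfl⟩
    rw [Submodule.map_smul''] at this
    exact Submodule.smul_mono le_rfl le_top this

theorem len_quotient_smul_top_pi (I : Ideal R) (n : ℕ) :
    len R ((Fin n → A) ⧸ I • (⊤ : Submodule R (Fin n → A))) =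
      n * len R (A ⧸ I • (⊤ : Submodule R A)) := by
  rw [← len_pi, smul_top_pi]
  exact (Submodule.quotientPi _).len_eq

theorem len_quotient_maximalIdeal [IsLocalRing R] :
    len R (R ⧸ maximalIdeal R • (⊤ : Submodule R R)) = 1 := by
  have : IsSimpleModule R (R ⧸ maximalIdeal R) :=
    isSimpleModule_iff_isCoatom.2 (maximalIdeal.isMaximal R).1
  rw [len, Ideal.smul_eq_mul, Ideal.mul_top, Module.length_eq_one]
  rfl

theorem len_quotient_smul_top_le_of_surjective [IsArtinianRing R] {B : Type*} [AddCommGroup B]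
    [Module R B] [Module.Finite R A] [Module.Finite R B] {f : A →ₗ[R] B}
    (hf : Function.Surjective f) (I : Ideal R) :
    len R (B ⧸ I • (⊤ : Submodule R B)) ≤ len R (A ⧸ I • (⊤ : Submodule R A)) :=
  len_le_of_surjective (f := Submodule.mapQ _ _ f (Submodule.smul_top_le_comap_smul_top I f))
    fun y => by
      obtain ⟨y, rfl⟩ := Submodule.mkQ_surjective _ y
      obtain ⟨x, rfl⟩ := hf y
      exact ⟨Submodule.Quotient.mk x, rfl⟩

end Quotient

section CocyclesBound

variable {R : Type*} [CommRing R] [IsLocalRing R] [IsArtinianRing R]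
  {A C S : Type*} [AddCommGroup A] [Module R A] [AddCommGroup C] [Module R C]
  [AddCommGroup S] [Module R S] {p q n : ℕ}
  {d : (Fin q → R) →ₗ[R] (Fin p → R)} {d' : S →ₗ[R] (Fin q → R)}

namespace Cocycles

/-- The cocycles with values in `Rⁿ` are the image of the free module `Hom(Rᵖ, Rⁿ)`, so they need
at most `p * n` generators. -/
theorem len_quotient_smul_top_le (h : d ∘ₗ d' = 0)
    (hex : ∀ φ : (Fin q → R) →ₗ[R] R, φ ∘ₗ d' = 0 → ∃ ψ : (Fin p → R) →ₗ[R] R, ψ ∘ₗ d = φ) :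
    len R (Cocycles d' (Fin n → R) ⧸
      maximalIdeal R • (⊤ : Submodule R (Cocycles d' (Fin n → R)))) ≤ p * n := by
  let e := (Pi.basisFun R (Fin p)).constr R (M' := Fin n → R)
  have hs : Function.Surjective ((coboundary d d' h (Fin n → R)) ∘ₗ e.toLinearMap) :=
    (coboundary_pi_surjective h hex n).comp e.surjective
  refine (len_quotient_smul_top_le_of_surjective hs _).trans ?_
  rw [len_quotient_smul_top_pi, len_quotient_smul_top_pi, len_quotient_maximalIdeal, mul_one]

omit [IsArtinianRing R] in
/-- Homomorphisms with values in a module killed by `𝔪` are cocycles when `d'` is minimal. -/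
theorem comp_eq_zero_of_smul_eq_bot
    (hmin : LinearMap.range d' ≤ maximalIdeal R • (⊤ : Submodule R (Fin q → R)))
    (hA : maximalIdeal R • (⊤ : Submodule R A) = ⊥) (φ : (Fin q → R) →ₗ[R] A) : φ ∘ₗ d' = 0 := by
  ext x
  have h : φ (d' x) ∈ (maximalIdeal R • (⊤ : Submodule R (Fin q → R))).map φ :=
    ⟨_, hmin ⟨x, rfl⟩, rfl⟩
  rw [Submodule.map_smul''] at h
  have := Submodule.smul_mono le_rfl le_top h
  rwa [hA] at this

/-- The cocycles with values in `C` contain `Hom(Rᑫ, W)`, of length `q * len W`, and the excess `ρ`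
of their length over this bounds `𝔪` times the cocycles with values in `C`, hence also `𝔪` times
the cocycles with values in `Rⁿ`, up to the cocycles with values in `A`. -/
theorem exists_len_eq (h : d ∘ₗ d' = 0)
    (hex : ∀ φ : (Fin q → R) →ₗ[R] R, φ ∘ₗ d' = 0 → ∃ ψ : (Fin p → R) →ₗ[R] R, ψ ∘ₗ d = φ)
    (hmin : LinearMap.range d' ≤ maximalIdeal R • (⊤ : Submodule R (Fin q → R)))
    [Module.Finite R A] [Module.Finite R C] {f : A →ₗ[R] (Fin n → R)} {g : (Fin n → R) →ₗ[R] C}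
    (hf : Function.Injective f) (hfg : Function.Exact f g)
    (W : Submodule R C) (hW : maximalIdeal R • (⊤ : Submodule R W) = ⊥) (s : Finset R)
    (hs : Ideal.span (s : Set R) = maximalIdeal R) :
    ∃ ρ : ℕ, len R (Cocycles d' C) = q * len R W + ρ ∧
      n * len R (Cocycles d' R) ≤ p * n + len R (Cocycles d' A) + s.card * ρ := by
  -- the cocycles with values in `W`; they are killed by `𝔪`
  let Y : Submodule R (Cocycles d' C) := LinearMap.range (map d' W.subtype)
  have hY : len R Y = q * len R W := by
    have h1 := (LinearEquiv.ofInjective _ (map_injective d' W.subtype_injective)).len_eq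
    have h2 : Function.Bijective (toHom d' W) := ⟨toHom_injective d', fun φ =>
      ⟨mk φ (comp_eq_zero_of_smul_eq_bot hmin hW φ), rfl⟩⟩
    rw [← h1, ← len_hom]
    exact (LinearEquiv.ofBijective _ h2).len_eq
  have hmY : maximalIdeal R • Y = ⊥ := by
    rw [eq_bot_iff, Submodule.smul_le]
    rintro r hr _ ⟨φ, rfl⟩
    refine ext fun x => ?_
    have : r • toHom d' W φ x ∈ maximalIdeal R • (⊤ : Submodule R W) :=
      Submodule.smul_mem_smul hr trivial
    rw [hW] at this
    exact congrArg Subtype.val this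
  have h1 := len_add_len_quotient Y
  have h2 := len_span_smul_top_le s Y (by rw [hs, hmY])
  rw [hs] at h2
  have h3 := len_inf_ker_add_len_map (map d' g)
    (maximalIdeal R • (⊤ : Submodule R (Cocycles d' (Fin n → R))))
  have h4 : len R ((maximalIdeal R • (⊤ : Submodule R (Cocycles d' (Fin n → R)))).map
      (map d' g)) ≤ len R ↥(maximalIdeal R • (⊤ : Submodule R (Cocycles d' C))) := by
    rw [Submodule.map_smul'']
    exact len_mono (Submodule.smul_mono le_rfl le_top)
  have h5 : len R ↥((maximalIdeal R • (⊤ : Submodule R (Cocycles d' (Fin n → R)))) ⊓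
      LinearMap.ker (map d' g)) ≤ len R (LinearMap.ker (map d' g)) := len_mono inf_le_right
  have h6 := len_add_len_quotient (maximalIdeal R • (⊤ : Submodule R (Cocycles d' (Fin n → R))))
  have h7 := len_quotient_smul_top_le (n := n) h hex
  have h8 := (LinearEquiv.ofInjective _ (map_injective d' hf)).len_eq
  have h9 := (piEquiv d' n).len_eq
  rw [len_pi] at h9
  rw [(map_exact d' hf hfg).linearMap_ker_eq] at h3 h5
  exact ⟨len R (Cocycles d' C ⧸ Y), by omega, by omega⟩

end Cocycles

end CocyclesBound

/-! ### The associated graded ring and the associated graded complex -/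

section Graded

variable (R : Type u) [CommRing R] [IsLocalRing R]

/-- The dimension of `𝔪^p / 𝔪^(p+1)`. -/
noncomputable def grDim (p : ℕ) : ℕ :=
  len R (GrPiece R R p)

instance [IsNoetherianRing R] (M : Type v) [AddCommGroup M] [Module R M] [Module.Finite R M]
    (p : ℕ) : Module.Finite (R ⧸ maximalIdeal R) (GrPiece R M p) :=
  Module.Finite.of_restrictScalars_finite R _ _

theorem coeff_hilbertSeries [IsNoetherianRing R] (p : ℕ) :
    PowerSeries.coeff p (hilbertSeries R) = (grDim R p : ℤ) := by
  have h1 : Module.length R (GrPiece R R p) = Module.length (R ⧸ maximalIdeal R) (GrPiece R R p) :=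
    Module.length_eq_of_surjective Ideal.Quotient.mk_surjective
  have h2 : Module.length (R ⧸ maximalIdeal R) (GrPiece R R p) =
      Module.finrank (R ⧸ maximalIdeal R) (GrPiece R R p) := by
    let : Field (R ⧸ maximalIdeal R) := Ideal.Quotient.field _
    exact Module.length_eq_finrank (R ⧸ maximalIdeal R) (GrPiece R R p)
  rw [hilbertSeries, PowerSeries.coeff_mk, grDim, len, h1, h2, ENat.toNat_natCast]

theorem len_pow_zero_smul_top : len R ↥(maximalIdeal R ^ 0 • (⊤ : Submodule R R)) = len R R := by
  rw [pow_zero, Ideal.one_eq_top, Submodule.top_smul, Submodule.topEquiv.len_eq]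

theorem len_smul_top_pi {R : Type*} [CommRing R] [IsArtinianRing R] (I : Ideal R) (r : ℕ) :
    len R ↥(I • (⊤ : Submodule R (Fin r → R))) = r * len R ↥(I • (⊤ : Submodule R R)) := by
  have h1 := len_add_len_quotient (I • (⊤ : Submodule R (Fin r → R)))
  have h2 := len_add_len_quotient (I • (⊤ : Submodule R R))
  rw [len_quotient_smul_top_pi, len_pi, ← h2, mul_add] at h1
  exact Nat.add_right_cancel h1

variable [IsArtinianRing R]

theorem len_pow_smul_top (M : Type v) [AddCommGroup M] [Module R M] [Module.Finite R M] (p : ℕ) :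
    len R ↥(maximalIdeal R ^ p • (⊤ : Submodule R M)) =
      len R ↥(maximalIdeal R ^ (p + 1) • (⊤ : Submodule R M)) + len R (GrPiece R M p) := by
  rw [← len_add_len_quotient (maximalIdeal R • (⊤ : Submodule R
    ↥(maximalIdeal R ^ p • (⊤ : Submodule R M))))]
  congr 1
  rw [((maximalIdeal R • (⊤ : Submodule R
    ↥(maximalIdeal R ^ p • (⊤ : Submodule R M)))).equivMapOfInjective _
      (Submodule.subtype_injective _)).len_eq, Submodule.map_smul'', Submodule.map_subtype_top,
      pow_succ', mul_smul]

theorem len_grPiece_pi (r p : ℕ) : len R (GrPiece R (Fin r → R) p) = r * grDim R p := by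
  have h1 := len_pow_smul_top R (Fin r → R) p
  have h2 := len_pow_smul_top R R p
  rw [len_smul_top_pi, len_smul_top_pi, h2, mul_add] at h1
  exact (Nat.add_left_cancel h1).symm

theorem grDim_zero : grDim R 0 = 1 := by
  have h1 := len_pow_smul_top R R 0
  have h2 := len_add_len_quotient (maximalIdeal R • (⊤ : Submodule R R))
  rw [zero_add, pow_one, len_pow_zero_smul_top, ← h2, len_quotient_maximalIdeal] at h1
  exact (Nat.add_left_cancel h1).symm

variable {R} (hm4 : maximalIdeal R ^ 4 = ⊥)

include hm4 in
omit [IsArtinianRing R] in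
theorem pow_smul_eq_bot {M : Type v} [AddCommGroup M] [Module R M] (S : Submodule R M) {p : ℕ}
    (hp : 4 ≤ p) : maximalIdeal R ^ p • S = ⊥ := by
  have h := Submodule.smul_mono_left (N := S) (Ideal.pow_le_pow_right (I := maximalIdeal R) hp)
  rwa [hm4, Submodule.bot_smul, le_bot_iff] at h

include hm4

omit [IsArtinianRing R] in
theorem len_pow_smul_top_of_four_le {p : ℕ} (hp : 4 ≤ p) :
    len R ↥(maximalIdeal R ^ p • (⊤ : Submodule R R)) = 0 := by
  rw [pow_smul_eq_bot hm4 _ hp, len_eq_zero_of_subsingleton]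

theorem grDim_of_four_le {p : ℕ} (hp : 4 ≤ p) : grDim R p = 0 := by
  have h1 := len_pow_smul_top R R p
  rw [len_pow_smul_top_of_four_le hm4 hp] at h1
  exact (add_eq_zero.1 h1.symm).2

theorem len_pow_three_smul_top :
    len R ↥(maximalIdeal R ^ 3 • (⊤ : Submodule R R)) = grDim R 3 := by
  rw [len_pow_smul_top, len_pow_smul_top_of_four_le hm4 le_rfl, zero_add, grDim]

theorem len_pow_two_smul_top :
    len R ↥(maximalIdeal R ^ 2 • (⊤ : Submodule R R)) = grDim R 2 + grDim R 3 := by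
  rw [len_pow_smul_top, len_pow_three_smul_top hm4, add_comm]
  rfl

theorem len_self : len R R = 1 + grDim R 1 + grDim R 2 + grDim R 3 := by
  have h0 := len_pow_smul_top R R 0
  have h1 := len_pow_smul_top R R 1
  have h2 := grDim_zero R
  rw [len_pow_two_smul_top hm4] at h1
  rw [len_pow_zero_smul_top, zero_add] at h0
  unfold grDim at h1 h2 ⊢
  omega

theorem grDim_three_pos (hm3 : maximalIdeal R ^ 3 ≠ ⊥) : 0 < grDim R 3 := by
  rw [← len_pow_three_smul_top hm4, Nat.pos_iff_ne_zero]
  intro h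
  have h1 := coe_len R ↥(maximalIdeal R ^ 3 • (⊤ : Submodule R R))
  rw [h, Nat.cast_zero, eq_comm, Module.length_eq_zero_iff, Submodule.subsingleton_iff_eq_bot,
    Ideal.smul_eq_mul, Ideal.mul_top] at h1
  exact hm3 h1

end Graded

namespace MinimalFreeResolution

variable {R : Type u} [CommRing R] [IsLocalRing R]
  {M : Type v} [AddCommGroup M] [Module R M] (F : MinimalFreeResolution R M)

theorem d_comp_d (i : ℕ) : F.d i ∘ₗ F.d (i + 1) = 0 :=
  (F.exact_succ i).linearMap_comp_eq_zero

theorem exact_subtype_rangeRestrict (j : ℕ) :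
    Function.Exact (LinearMap.range (F.d (j + 1))).subtype (F.d j).rangeRestrict := by
  rw [LinearMap.exact_iff, Submodule.range_subtype, LinearMap.ker_rangeRestrict,
    (F.exact_succ j).linearMap_ker_eq]

theorem len_range_add_len_range [IsArtinianRing R] (j : ℕ) :
    len R (LinearMap.range (F.d (j + 1))) + len R (LinearMap.range (F.d j)) =
      F.rank (j + 1) * len R R := by
  rw [← len_pi, ← len_ker_add_len_range (F.d j), (F.exact_succ j).linearMap_ker_eq]

variable (hm4 : maximalIdeal R ^ 4 = ⊥)
include hm4

theorem grD_two_surjective {i : ℕ} (h : F.GrExactAtSucc i) :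
    Function.Surjective (F.grD (i + 1) 2) := by
  have : Subsingleton (GrPiece R (Fin (F.rank i) → R) 4) := by
    have : Subsingleton ↥(maximalIdeal R ^ 4 • (⊤ : Submodule R (Fin (F.rank i) → R))) := by
      rw [Submodule.subsingleton_iff_eq_bot, pow_smul_eq_bot hm4 _ le_rfl]
    infer_instance
  exact fun y => (h.2 2 y).1 (Subsingleton.elim _ _)

/-- The Betti numbers of an eventually linear resolution satisfy a linear recurrence whose
characteristic polynomial is `X³ H_R(-1/X)`. -/
theorem rank_recurrence [IsArtinianRing R] {n : ℕ} (h : ∀ i ≥ n, F.GrExactAtSucc i) {i : ℕ}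
    (hi : n ≤ i) :
    F.rank (i + 4) + grDim R 2 * F.rank (i + 2) =
      grDim R 1 * F.rank (i + 3) + grDim R 3 * F.rank (i + 1) := by
  have key := len_add_of_exact_of_exact (h (i + 3) (by omega)).1 ((h (i + 2) (by omega)).2 0)
    ((h (i + 1) (by omega)).2 1) (F.grD_two_surjective hm4 (h i hi))
  simp only [len_grPiece_pi, grDim_zero, mul_one, add_assoc, Nat.reduceAdd] at key
  simp only [mul_comm (grDim R _), key]

/-- Linearity in the top degree: `𝔪³ F_j = d(𝔪² F_(j+1))`. -/
theorem map_pow_two_smul_top {i : ℕ} (h : F.GrExactAtSucc i) :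
    (maximalIdeal R ^ 2 • (⊤ : Submodule R (Fin (F.rank (i + 2)) → R))).map (F.d (i + 1)) =
      maximalIdeal R ^ 3 • (⊤ : Submodule R (Fin (F.rank (i + 1)) → R)) := by
  apply le_antisymm
  · rintro _ ⟨x, hx, rfl⟩
    exact F.d_mem _ _ x hx
  · intro y hy
    obtain ⟨x, hx⟩ := F.grD_two_surjective hm4 h (Submodule.Quotient.mk ⟨y, hy⟩)
    obtain ⟨x, rfl⟩ := Submodule.mkQ_surjective _ x
    refine ⟨x.1, x.2, ?_⟩
    have hq := (Submodule.Quotient.eq _).1 hx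
    have : maximalIdeal R • (⊤ : Submodule R
        ↥(maximalIdeal R ^ 3 • (⊤ : Submodule R (Fin (F.rank (i + 1)) → R)))) = ⊥ := by
      apply Submodule.map_injective_of_injective (Submodule.subtype_injective _)
      rw [Submodule.map_smul'', Submodule.map_subtype_top, Submodule.map_bot, ← mul_smul,
        ← pow_succ', pow_smul_eq_bot hm4 _ le_rfl]
    erw [this] at hq
    have := congrArg Subtype.val ((Submodule.mem_bot R).1 hq)
    exact sub_eq_zero.1 this

/-- The lower bound in `len_range`: the length is computed modulo `𝔪³ F_j`, up to the contribution
of the next syzygy modulo `𝔪²`, which has at most `rank (i + 3)` generators. -/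
theorem len_range_ge [IsArtinianRing R] {i : ℕ} (h : F.GrExactAtSucc i) :
    (1 + grDim R 1) * F.rank (i + 2) + grDim R 3 * F.rank (i + 1) ≤
      len R (LinearMap.range (F.d (i + 1))) + F.rank (i + 3) := by
  set T := maximalIdeal R ^ 2 • (⊤ : Submodule R (Fin (F.rank (i + 2)) → R)) with hT
  have h1 := F.len_range_add_len_range (i + 1)
  have h2 := len_inf_ker_add_len_map (F.d (i + 1)) T
  have h3 := len_inf_ker_add_len_map T.mkQ (LinearMap.range (F.d (i + 2)))
  rw [hT, F.map_pow_two_smul_top hm4 h, len_smul_top_pi, len_smul_top_pi,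
    len_pow_two_smul_top hm4, len_pow_three_smul_top hm4, (F.exact_succ (i + 1)).linearMap_ker_eq,
    ← hT, inf_comm] at h2
  rw [Submodule.ker_mkQ] at h3
  have h4 : len R ((LinearMap.range (F.d (i + 2))).map T.mkQ) ≤ F.rank (i + 3) := by
    have hker : maximalIdeal R • (⊤ : Submodule R (Fin (F.rank (i + 3)) → R)) ≤
        LinearMap.ker (T.mkQ ∘ₗ F.d (i + 2)) := by
      intro x hx
      rw [← pow_one (maximalIdeal R)] at hx
      exact (Submodule.Quotient.mk_eq_zero T).2 (F.d_mem (i + 2) 1 x hx)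
    have h5 := len_quotient_smul_top_pi (A := R) (maximalIdeal R) (F.rank (i + 3))
    rw [len_quotient_maximalIdeal, mul_one] at h5
    rw [← LinearMap.range_comp, ← Submodule.range_liftQ _ _ hker]
    refine le_of_le_of_eq ?_ h5
    exact len_le_of_surjective (LinearMap.surjective_rangeRestrict _)
  rw [len_self hm4] at h1
  nlinarith

/-- The length of a high syzygy of an eventually linear resolution. By the recurrence, the two sides
of `len_range_ge` have the same sum in consecutive degrees, so the inequality is an equality. -/
theorem len_range [IsArtinianRing R] {n : ℕ} (h : ∀ i ≥ n, F.GrExactAtSucc i) {i : ℕ} (hi : n ≤ i) :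
    (1 + grDim R 1) * F.rank (i + 2) + grDim R 3 * F.rank (i + 1) =
      len R (LinearMap.range (F.d (i + 1))) + F.rank (i + 3) := by
  have h1 := F.len_range_ge hm4 (h i hi)
  have h2 := F.len_range_ge hm4 (h (i + 1) (by omega))
  have h3 := F.len_range_add_len_range (i + 1)
  have h4 := F.rank_recurrence hm4 h hi
  rw [len_self hm4] at h3
  simp only [add_assoc, Nat.reduceAdd] at h1 h2 h3 h4 ⊢
  nlinarith

end MinimalFreeResolution

/-! ### Ratio limits -/

section Asymptotics

theorem tendsto_zero_of_le_mul_add {x δ : ℕ → ℝ} {r : ℝ} (hx : ∀ j, 0 ≤ x j) (hr0 : 0 ≤ r)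
    (hr1 : r < 1) (hδ : Tendsto δ atTop (𝓝 0)) (h : ∀ᶠ j in atTop, x (j + 1) ≤ r * x j + δ j) :
    Tendsto x atTop (𝓝 0) := by
  rw [Metric.tendsto_atTop]
  intro ε hε
  have hε' : 0 < ε / 2 * (1 - r) := by
    have : 0 < 1 - r := by linarith
    positivity
  obtain ⟨N, hN⟩ := eventually_atTop.1 (h.and (hδ.eventually (gt_mem_nhds hε')))
  have hk : ∀ k, x (N + k) ≤ ε / 2 + r ^ k * x N := by
    intro k
    induction k with
    | zero => simp; linarith
    | succ k ih =>
      obtain ⟨h1, h2⟩ := hN (N + k) (by omega)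
      have h3 := mul_le_mul_of_nonneg_left ih hr0
      rw [← add_assoc, pow_succ]
      nlinarith
  have hlim : Tendsto (fun k => r ^ k * x N) atTop (𝓝 0) := by
    simpa using (tendsto_pow_atTop_nhds_zero_of_lt_one hr0 hr1).mul_const (x N)
  obtain ⟨K, hK⟩ := eventually_atTop.1 (hlim.eventually (gt_mem_nhds (half_pos hε)))
  refine ⟨N + K, fun j hj => ?_⟩
  obtain ⟨k, rfl⟩ := Nat.exists_eq_add_of_le (show N ≤ j by omega)
  rw [Real.dist_eq, sub_zero, abs_of_nonneg (hx _)]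
  have := hk k
  have := hK k (by omega)
  linarith

/-- A variant of the Stolz–Cesàro theorem: if `u` grows like a geometric sequence of ratio `q > 1`
and `z (j + 1) + κ * z j` is asymptotic to `p * u j`, then `z` is asymptotic to
`p / (q + κ) * u`. -/
theorem tendsto_div_of_tendsto_add_mul_div {u z : ℕ → ℝ} {q κ p : ℝ} (hq : 1 < q) (hκ : |κ| ≤ 1)
    (hu : ∀ᶠ j in atTop, 0 < u j) (hr : Tendsto (fun j => u (j + 1) / u j) atTop (𝓝 q))
    (hz : Tendsto (fun j => (z (j + 1) + κ * z j) / u j) atTop (𝓝 p)) :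
    Tendsto (fun j => z j / u j) atTop (𝓝 (p / (q + κ))) := by
  have hqκ : 0 < q + κ := by linarith [neg_le_of_abs_le hκ]
  set y := p / (q + κ) with hy
  have hp : p = (q + κ) * y := by rw [hy]; field_simp
  set r := 2 / (1 + q) with hrdef
  have hr1 : r < 1 := by rw [hrdef, div_lt_one] <;> linarith
  have hr0 : 0 < r := by positivity
  set δ : ℕ → ℝ := fun j => |(z (j + 1) + κ * z j) / u j - p + (q - u (j + 1) / u j) * y| with hδ
  have hδ0 : Tendsto δ atTop (𝓝 0) := by
    have := ((hz.sub_const p).add ((hr.const_sub q).mul_const y)).abs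
    simpa using this
  have hw : Tendsto (fun j => |z j / u j - y|) atTop (𝓝 0) := by
    refine tendsto_zero_of_le_mul_add (fun j => abs_nonneg _) hr0.le hr1
      (by simpa using hδ0.const_mul r) ?_
    have hlarge : ∀ᶠ j in atTop, (1 + q) / 2 < u (j + 1) / u j :=
      hr.eventually (lt_mem_nhds (by linarith))
    filter_upwards [hu, (tendsto_add_atTop_nat 1).eventually hu, hlarge] with j h0 h1 h2
    have hpos : 0 < u (j + 1) / u j := by positivity
    have heq : z (j + 1) / u (j + 1) - y = (u (j + 1) / u j)⁻¹ *
        (((z (j + 1) + κ * z j) / u j - p + (q - u (j + 1) / u j) * y) - κ * (z j / u j - y)) := by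
      rw [hp]
      field_simp
      ring
    have hinv : (u (j + 1) / u j)⁻¹ ≤ r := by
      rw [inv_le_comm₀ hpos hr0, hrdef, inv_div]
      exact h2.le
    have hκ' : |κ * (z j / u j - y)| ≤ |z j / u j - y| := by
      rw [abs_mul]
      exact mul_le_of_le_one_left (abs_nonneg _) hκ
    rw [heq, abs_mul, abs_of_pos (inv_pos.2 hpos), ← mul_add]
    refine mul_le_mul hinv ((abs_sub _ _).trans ?_) (abs_nonneg _) hr0.le
    rw [hδ]
    linarith
  rw [tendsto_iff_dist_tendsto_zero]
  exact hw

/-- The shape of the hypotheses in the definitions of polynomial and exponential growth, with `g`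
the comparison sequence, says that `b / g` converges to `β`. -/
theorem tendsto_div_of_close {b g r : ℕ → ℝ} {β : ℝ} (hg : ∀ᶠ i in atTop, 0 < g i)
    (hr : Tendsto (fun i => r i / g i) atTop (𝓝 0))
    (h : ∀ᶠ i in atTop, β * g i - r i ≤ b i ∧ b i ≤ β * g i + r i) :
    Tendsto (fun i => b i / g i) atTop (𝓝 β) := by
  have h1 : Tendsto (fun i => β - r i / g i) atTop (𝓝 β) := by simpa using hr.const_sub β
  have h2 : Tendsto (fun i => β + r i / g i) atTop (𝓝 β) := by simpa using hr.const_add β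
  refine tendsto_of_tendsto_of_tendsto_of_le_of_le' h1 h2 ?_ ?_
  · filter_upwards [hg, h] with i hi h
    rw [le_div_iff₀ hi, sub_mul, div_mul_cancel₀ _ hi.ne']
    exact h.1
  · filter_upwards [hg, h] with i hi h
    rw [div_le_iff₀ hi, add_mul, div_mul_cancel₀ _ hi.ne']
    exact h.2

/-- The sequence `b` is eventually positive and its consecutive ratios converge to `q`. -/
structure HasRatio (b : ℕ → ℝ) (q : ℝ) : Prop where
  pos : ∀ᶠ i in atTop, 0 < b i
  tendsto : Tendsto (fun i => b (i + 1) / b i) atTop (𝓝 q)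

theorem HasRatio.of_close {b g r : ℕ → ℝ} {β q : ℝ} (hβ : 0 < β) (hg : HasRatio g q)
    (hr : Tendsto (fun i => r i / g i) atTop (𝓝 0))
    (h : ∀ᶠ i in atTop, β * g i - r i ≤ b i ∧ b i ≤ β * g i + r i) : HasRatio b q := by
  have hlim := tendsto_div_of_close hg.pos hr h
  have hpos : ∀ᶠ i in atTop, 0 < b i := by
    filter_upwards [hg.pos, hlim.eventually (lt_mem_nhds hβ)] with i h1 h2
    exact (div_pos_iff_of_pos_right h1).1 h2
  refine ⟨hpos, ?_⟩
  have h1 := ((hlim.comp (tendsto_add_atTop_nat 1)).div hlim hβ.ne').mul hg.tendsto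
  rw [div_self hβ.ne', one_mul] at h1
  refine h1.congr' ?_
  filter_upwards [hg.pos, (tendsto_add_atTop_nat 1).eventually hg.pos, hpos] with i h1 h2 h3
  simp only [Function.comp_apply, Pi.div_apply]
  field_simp

theorem HasRatio.mul {b c : ℕ → ℝ} {p q : ℝ} (hb : HasRatio b p) (hc : HasRatio c q) :
    HasRatio (fun i => b i * c i) (p * q) :=
  ⟨by filter_upwards [hb.pos, hc.pos] with i h1 h2 using mul_pos h1 h2,
    (hb.tendsto.mul hc.tendsto).congr fun i => div_mul_div_comm _ _ _ _⟩

theorem HasRatio.shift {b : ℕ → ℝ} {p : ℝ} (hb : HasRatio b p) (o : ℕ) :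
    HasRatio (fun i => b (o + i)) p := by
  have h := tendsto_add_atTop_nat o
  simp_rw [add_comm _ o] at h
  exact ⟨h.eventually hb.pos, hb.tendsto.comp h⟩

theorem HasRatio.pow {b : ℕ → ℝ} {p : ℝ} (hb : HasRatio b p) (k : ℕ) :
    Tendsto (fun i => b (i + k) / b i) atTop (𝓝 (p ^ k)) := by
  induction k with
  | zero =>
    refine (tendsto_congr' ?_).2 (by rw [pow_zero]; exact tendsto_const_nhds)
    filter_upwards [hb.pos] with i hi using div_self hi.ne'
  | succ k ih =>
    have h1 := (hb.tendsto.comp (tendsto_add_atTop_nat k)).mul ih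
    rw [← pow_succ'] at h1
    refine h1.congr' ?_
    filter_upwards [(tendsto_add_atTop_nat k).eventually hb.pos] with i hi
    rw [Function.comp_apply, div_mul_div_cancel₀ hi.ne', add_assoc]

theorem HasExponentialGrowthOfBase.hasRatio {a : ℝ} {b : ℕ → ℕ}
    (h : HasExponentialGrowthOfBase a b) : HasRatio (fun i => (b i : ℝ)) a := by
  obtain ⟨ha, β, r, hβ, hr, hb⟩ := h
  refine HasRatio.of_close (g := fun i => a ^ i) hβ
    ⟨Eventually.of_forall fun i => by positivity, ?_⟩ hr hb
  refine (tendsto_congr fun i => ?_).2 tendsto_const_nhds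
  rw [pow_succ, mul_div_cancel_left₀ _ (by positivity)]

theorem HasPolynomialGrowth.hasRatio {b : ℕ → ℕ}
    (h : HasPolynomialGrowth b) : HasRatio (fun i => (b i : ℝ)) 1 := by
  obtain ⟨n, α, r, hα, hr, hb⟩ := h
  have hpos : ∀ᶠ i : ℕ in atTop, 0 < (i : ℝ) := by
    filter_upwards [eventually_gt_atTop 0] with i hi
    exact_mod_cast hi
  refine HasRatio.of_close (g := fun i => (i : ℝ) ^ n) hα
    ⟨hpos.mono fun i hi => by positivity, ?_⟩ hr hb
  have h1 : Tendsto (fun i : ℕ => (1 + 1 / (i : ℝ)) ^ n) atTop (𝓝 ((1 + 0) ^ n)) :=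
    (tendsto_one_div_atTop_nhds_zero_nat.const_add 1).pow n
  rw [add_zero, one_pow] at h1
  refine h1.congr' ?_
  filter_upwards [hpos] with i hi
  rw [← div_pow]
  congr 1
  push_cast
  field_simp

/-- The ratio limit of a solution of a linear recurrence is a root of the characteristic
polynomial. -/
theorem HasRatio.root {x : ℕ → ℕ} {q : ℝ} (hx : HasRatio (fun i => (x i : ℝ)) q) {e f s n : ℕ}
    (h : ∀ i ≥ n, x (i + 4) + f * x (i + 2) = e * x (i + 3) + s * x (i + 1)) :
    q ^ 3 + f * q = e * q ^ 2 + s := by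
  have hs := hx.shift 1
  have h1 := (hs.pow 3).add ((hs.pow 1).const_mul (f : ℝ))
  have h2 := ((hs.pow 2).const_mul (e : ℝ)).add_const (s : ℝ)
  rw [pow_one] at h1
  refine tendsto_nhds_unique h1 (h2.congr' ?_)
  filter_upwards [hs.pos, eventually_ge_atTop n] with i h0 hi
  have := h i hi
  rw [show 1 + (i + 3) = i + 4 by omega, show 1 + (i + 2) = i + 3 by omega,
    show 1 + (i + 1) = i + 2 by omega]
  rw [add_comm 1 i] at h0 ⊢
  field_simp
  have h4 : ((x (i + 4) : ℝ) + f * x (i + 2)) = e * x (i + 3) + s * x (i + 1) := by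
    exact_mod_cast this
  linarith

end Asymptotics

/-! ### The numerical argument -/

theorem eq_one_of_mul_lt {e s : ℕ} {a : ℝ} (ha : 1 < a) (hs : 0 < s)
    (hroot : a * e = a ^ 2 + a + s) (hlt : s * a < e) : s = 1 := by
  by_contra hne
  have hs2 : (2 : ℝ) ≤ s := by exact_mod_cast (by omega : 2 ≤ s)
  -- substituting the root equation, `s * a < e` reads `(a + 1) * ((s - 1) * a - s) < 0`
  have h1 : (s - 1) * a < s := by
    have : (a + 1) * ((s - 1) * a - s) < 0 := by nlinarith
    nlinarith
  have h2 : a < s := by nlinarith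
  -- the integer `e - 1 = a + s / a` would lie strictly between `s` and `s + 1`
  have h3 : (s : ℝ) + 1 < e := by
    have : 0 < a * (e - 1 - s) := by nlinarith
    nlinarith
  have h4 : (e : ℝ) < s + 2 := by
    have : a * (e - 2 - s) < 0 := by nlinarith [mul_pos (sub_pos.2 ha) (sub_pos.2 h2)]
    nlinarith
  have h3' : s + 1 < e := by exact_mod_cast h3
  have h4' : e < s + 2 := by exact_mod_cast h4
  omega

section Numerical

variable {c b t l : ℕ → ℕ} {z : ℕ → ℕ → ℕ} {e f s g n : ℕ} {a : ℝ}

/-- The relation `hz` determines the growth of `z` along each diagonal. -/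
theorem tendsto_diagonal (ha : 1 < a) (hc : HasRatio (fun i => (c i : ℝ)) 1)
    (hb : HasRatio (fun i => (b i : ℝ)) a) {τ lam : ℝ}
    (ht : Tendsto (fun i => (t i : ℝ) / b i) atTop (𝓝 τ))
    (hl : Tendsto (fun j => (l j : ℝ) / c j) atTop (𝓝 lam))
    (hz : ∀ i ≥ n, ∀ j, z (i + 1) (j + 1) + b i * l j = z i j + c (j + 1) * t (i + 1))
    {o : ℕ} (ho : n ≤ o) :
    Tendsto (fun j => (z (o + j) j : ℝ) / (c j * b (o + j))) atTop
      (𝓝 ((τ * a - lam) / (a - 1))) := by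
  have hu := hc.mul (hb.shift o)
  rw [one_mul] at hu
  refine tendsto_div_of_tendsto_add_mul_div (κ := -1) ha (by simp) hu.pos hu.tendsto ?_
  have hos := tendsto_add_atTop_nat (o + 1)
  have h1 := (hc.tendsto.mul ((ht.comp hos).mul (hb.shift o).tendsto)).sub hl
  rw [one_mul] at h1
  refine h1.congr' ?_
  filter_upwards [hc.pos, (hb.shift o).pos, (hb.shift (o + 1)).pos] with j h1 h2 h3
  have h4 : (z (o + (j + 1)) (j + 1) : ℝ) + b (o + j) * l j =
      z (o + j) j + c (j + 1) * t (o + (j + 1)) := by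
    exact_mod_cast hz (o + j) (by omega) j
  simp only [Function.comp_apply]
  rw [show j + (o + 1) = o + (j + 1) by omega]
  rw [show o + 1 + j = o + (j + 1) by omega] at h3
  rw [eq_sub_of_add_eq h4]
  field_simp
  ring

/-- The numerical heart of the argument. In the application `c` and `b` are the Betti numbers of
`M` and `N`, `t i` and `z i j` are the lengths of the modules of homomorphisms from the `i`-th
syzygy of `N` to `R` and to a syzygy of `M`, and `l j` is the length of that syzygy of `M`. -/
theorem eq_one_and_eq_of_relations (ha : 1 < a) (hc : HasRatio (fun i => (c i : ℝ)) 1)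
    (hb : HasRatio (fun i => (b i : ℝ)) a) (hs : 0 < s)
    (hcrec : ∀ i ≥ n, c (i + 4) + f * c (i + 2) = e * c (i + 3) + s * c (i + 1))
    (hbrec : ∀ i ≥ n, b (i + 4) + f * b (i + 2) = e * b (i + 3) + s * b (i + 1))
    (ht : ∀ i ≥ n, t i + t (i + 1) = b i * (1 + e + f + s))
    (hl : ∀ j ≥ n, (1 + e) * c (j + 1) + s * c j = l j + c (j + 2))
    (hz : ∀ i ≥ n, ∀ j, z (i + 1) (j + 1) + b i * l j = z i j + c (j + 1) * t (i + 1))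
    (hρ : ∀ i ≥ n, ∀ j ≥ n, ∃ ρ : ℕ, z (i + 1) j = b (i + 1) * (c j * s) + ρ ∧
      c (j + 1) * t (i + 1) ≤ b i * c (j + 1) + z (i + 1) (j + 1) + g * ρ) :
    s = 1 ∧ f = e := by
  have hc1 := hc.root hcrec
  have hb1 := hb.root hbrec
  have hf : (f : ℝ) = e + s - 1 := by linarith
  have ha0 : 0 < a := by linarith
  have hroot : a * e = a ^ 2 + a + s := by
    rw [hf] at hb1
    have : (a - 1) * (a * e - (a ^ 2 + a + s)) = 0 := by nlinarith
    rcases mul_eq_zero.1 this with h | h <;> linarith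
  have hτ : Tendsto (fun i => (t i : ℝ) / b i) atTop (𝓝 (2 * (e + s) / (a + 1))) := by
    refine tendsto_div_of_tendsto_add_mul_div ha (by simp) hb.pos hb.tendsto ?_
    refine (tendsto_congr' ?_).2 tendsto_const_nhds
    filter_upwards [hb.pos, eventually_ge_atTop n] with i h0 hi
    have h1 : (t i : ℝ) + t (i + 1) = b i * (1 + e + f + s) := by exact_mod_cast ht i hi
    rw [one_mul, add_comm, h1, mul_div_cancel_left₀ _ h0.ne', hf]
    ring
  have hlam : Tendsto (fun j => (l j : ℝ) / c j) atTop (𝓝 (e + s)) := by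
    have h1 := ((hc.tendsto.const_mul (1 + e : ℝ)).add_const (s : ℝ)).sub (hc.pow 2)
    have h2 : (1 + e : ℝ) * 1 + s - 1 ^ 2 = e + s := by ring
    rw [h2] at h1
    refine h1.congr' ?_
    filter_upwards [hc.pos, eventually_ge_atTop n] with j h0 hj
    have h3 : (1 + e : ℝ) * c (j + 1) + s * c j = l j + c (j + 2) := by exact_mod_cast hl j hj
    field_simp
    linarith
  have hdiag : ∀ o ≥ n, Tendsto (fun j => (z (o + j) j : ℝ) / (c j * b (o + j))) atTop
      (𝓝 ((e + s) / (a + 1))) := by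
    intro o ho
    have h1 := tendsto_diagonal ha hc hb hτ hlam hz ho
    have h2 : (2 * (e + s) / (a + 1) * a - (e + s)) / (a - 1) = (e + s : ℝ) / (a + 1) := by
      have : a - 1 ≠ 0 := by linarith
      field_simp
      ring
    rwa [h2] at h1
  set h : ℝ := (e + s) / (a + 1) with hh
  have hbs := hb.shift n
  have hbs1 := hb.shift (n + 1)
  -- `z (i, j + 1)` is on the neighbouring diagonal, which has the same limit
  have hoff : Tendsto (fun j => (z (n + 1 + j) (j + 1) : ℝ) / (c j * b (n + 1 + j))) atTop
      (𝓝 h) := by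
    have h1 := ((hdiag n le_rfl).comp (tendsto_add_atTop_nat 1)).mul hc.tendsto
    rw [mul_one] at h1
    refine h1.congr' ?_
    filter_upwards [hc.pos, (tendsto_add_atTop_nat 1).eventually hc.pos, hbs1.pos] with j h1 h2 h3
    simp only [Function.comp_apply]
    rw [show n + (j + 1) = n + 1 + j by omega]
    field_simp
  have hge : (s : ℝ) ≤ h := by
    refine ge_of_tendsto (hdiag (n + 1) (by omega)) ?_
    filter_upwards [hc.pos, hbs1.pos, eventually_ge_atTop n] with j h1 h2 hj
    obtain ⟨ρ, h3, -⟩ := hρ (n + j) (by omega) j hj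
    rw [le_div_iff₀ (by positivity)]
    rw [show n + j + 1 = n + 1 + j by omega] at h3
    rw [h3]
    push_cast
    nlinarith
  have hineq : 2 * h ≤ a⁻¹ + h + g * (h - s) := by
    have hleft : Tendsto (fun j => (c (j + 1) : ℝ) / c j * (t (n + 1 + j) / b (n + 1 + j))) atTop
        (𝓝 (2 * h)) := by
      have h1 := tendsto_add_atTop_nat (n + 1)
      simp_rw [add_comm _ (n + 1)] at h1
      have h2 := hc.tendsto.mul (hτ.comp h1)
      rw [one_mul, mul_div_assoc] at h2
      exact h2
    have hright := ((hc.tendsto.mul (hbs.tendsto.inv₀ ha0.ne')).add hoff).add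
      (((hdiag (n + 1) (by omega)).sub_const (s : ℝ)).const_mul (g : ℝ))
    rw [one_mul] at hright
    refine le_of_tendsto_of_tendsto hleft hright ?_
    filter_upwards [hc.pos, hbs.pos, hbs1.pos, eventually_ge_atTop n] with j h1 h2 h3 hj
    obtain ⟨ρ, h4, h5⟩ := hρ (n + j) (by omega) j hj
    rw [show n + j + 1 = n + 1 + j by omega] at h4 h5
    have h4' : (z (n + 1 + j) j : ℝ) = b (n + 1 + j) * (c j * s) + ρ := by exact_mod_cast h4
    have h5' : (c (j + 1) : ℝ) * t (n + 1 + j) ≤ b (n + j) * c (j + 1) + z (n + 1 + j) (j + 1) +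
      g * ρ := by exact_mod_cast h5
    rw [h4', show n + (j + 1) = n + 1 + j by omega]
    have h6 := div_le_div_of_nonneg_right h5' (by positivity : 0 ≤ (c j : ℝ) * b (n + 1 + j))
    calc _ = _ := by field_simp
      _ ≤ _ := h6
      _ = _ := by field_simp; ring
  have hlt : (s : ℝ) * a < e := by
    have hs1 : (1 : ℝ) ≤ s := by exact_mod_cast hs
    have h1 : h ≠ s := by
      intro heq
      rw [heq, sub_self, mul_zero] at hineq
      have := inv_lt_one_of_one_lt₀ ha
      linarith
    have h2 : (s : ℝ) < h := lt_of_le_of_ne hge h1.symm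
    rw [hh, lt_div_iff₀ (by linarith)] at h2
    linarith
  have hs1 := eq_one_of_mul_lt ha hs hroot hlt
  refine ⟨hs1, ?_⟩
  rw [hs1] at hf
  have : (f : ℝ) = e := by rw [hf]; push_cast; ring
  exact_mod_cast this

end Numerical

/-! ### The Hilbert series -/

section Main

variable {R : Type u} [CommRing R] [IsLocalRing R]

/-- The numerical relations of `eq_one_and_eq_of_relations` hold for the Betti numbers and the
lengths attached to the two resolutions. -/
theorem grDim_eq_of_resolutions [IsNoetherianRing R] (hm4 : maximalIdeal R ^ 4 = ⊥)
    (hm3 : maximalIdeal R ^ 3 ≠ ⊥) {M N : Type u} [AddCommGroup M] [Module R M]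
    [AddCommGroup N] [Module R N] (F : MinimalFreeResolution R M) (G : MinimalFreeResolution R N)
    (hF : F.EventuallyLinear) (hG : G.EventuallyLinear) (hM : HasPolynomialGrowth F.rank)
    (hN : HasExponentialGrowth G.rank) (hExt : ∀ᶠ i : ℕ in atTop, ExtToRingVanishes R N i) :
    grDim R 3 = 1 ∧ grDim R 2 = grDim R 1 := by
  have : IsArtinianRing R := (isArtinianRing_iff_isNilpotent_maximalIdeal R).2 ⟨4, hm4⟩
  obtain ⟨a, hN⟩ := hN
  obtain ⟨nF, hF⟩ := hF
  obtain ⟨nG, hG⟩ := hG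
  obtain ⟨nE, hExt⟩ := eventually_atTop.1 hExt
  obtain ⟨S, hS⟩ := (maximalIdeal R).fg_of_isNoetherianRing
  have hex := fun i (hi : nE ≤ i) => G.exists_comp_d_eq (hExt (i + 1) (by omega))
  refine eq_one_and_eq_of_relations (n := nF + nG + nE + 1) (g := S.card)
    (t := fun i => len R (Cocycles (G.d i) R)) (l := fun j => len R (LinearMap.range (F.d j)))
    (z := fun i j => len R (Cocycles (G.d i) (LinearMap.range (F.d j))))
    hN.1 hM.hasRatio hN.hasRatio (grDim_three_pos hm4 hm3)
    (fun i hi => F.rank_recurrence hm4 hF (by omega))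
    (fun i hi => G.rank_recurrence hm4 hG (by omega)) ?_ ?_ ?_ ?_
  · intro i hi
    rw [← len_self hm4]
    exact Cocycles.len_add_len (G.d_comp_d i) (hex i (by omega))
  · intro j hj
    obtain ⟨j, rfl⟩ := Nat.exists_eq_add_of_lt (show 0 < j by omega)
    rw [zero_add]
    exact F.len_range hm4 hF (by omega)
  · intro i hi j
    exact Cocycles.len_relation (G.d_comp_d i) (hex i (by omega)) (Submodule.subtype_injective _)
      (LinearMap.surjective_rangeRestrict _) (F.exact_subtype_rangeRestrict j)
  · intro i hi j hj
    obtain ⟨j, rfl⟩ := Nat.exists_eq_add_of_lt (show 0 < j by omega)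
    rw [zero_add]
    -- the image of `d` contains `𝔪³ F_j`, which is killed by `𝔪` as `𝔪⁴ = 0`
    set W := maximalIdeal R ^ 3 • (⊤ : Submodule R (Fin (F.rank (j + 1)) → R)) with hW
    have hle : W ≤ LinearMap.range (F.d (j + 1)) := by
      rw [hW, ← F.map_pow_two_smul_top hm4 (hF j (by omega))]
      exact LinearMap.map_le_range
    have hlen : len R (W.comap (LinearMap.range (F.d (j + 1))).subtype) =
        F.rank (j + 1) * grDim R 3 := by
      rw [(Submodule.comapSubtypeEquivOfLe hle).len_eq, len_smul_top_pi, len_pow_three_smul_top hm4]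
    have hbot : maximalIdeal R •
        (⊤ : Submodule R (W.comap (LinearMap.range (F.d (j + 1))).subtype)) = ⊥ := by
      apply Submodule.map_injective_of_injective (Submodule.subtype_injective _)
      apply Submodule.map_injective_of_injective (Submodule.subtype_injective _)
      rw [Submodule.map_smul'', Submodule.map_subtype_top, Submodule.map_smul'',
        Submodule.map_comap_subtype, inf_eq_right.2 hle, Submodule.map_bot, Submodule.map_bot, hW,
        ← mul_smul, ← pow_succ', pow_smul_eq_bot hm4 _ le_rfl]
    rw [← hlen]
    exact Cocycles.exists_len_eq (G.d_comp_d i) (hex i (by omega)) (G.minimal (i + 1))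
      (Submodule.subtype_injective _) (F.exact_subtype_rangeRestrict (j + 1)) _ hbot S hS

theorem hilbertSeries_eq_of_grDim_eq [IsNoetherianRing R] (hm4 : maximalIdeal R ^ 4 = ⊥)
    (h : grDim R 3 = 1 ∧ grDim R 2 = grDim R 1) :
    ∃ e : ℕ, hilbertSeries R =
      1 + (e : PowerSeries ℤ) * PowerSeries.X + (e : PowerSeries ℤ) * PowerSeries.X ^ 2 +
        PowerSeries.X ^ 3 := by
  have : IsArtinianRing R := (isArtinianRing_iff_isNilpotent_maximalIdeal R).2 ⟨4, hm4⟩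
  refine ⟨grDim R 1, PowerSeries.ext fun i => ?_⟩
  have hC : ((grDim R 1 : ℕ) : PowerSeries ℤ) = PowerSeries.C (grDim R 1 : ℤ) := by simp
  rw [coeff_hilbertSeries, hC]
  simp only [map_add, PowerSeries.coeff_C_mul, PowerSeries.coeff_X, PowerSeries.coeff_X_pow,
    PowerSeries.coeff_one]
  rcases i with _ | _ | _ | _ | i
  · simp [grDim_zero]
  · simp
  · simp [h.2]
  · simp [h.1]
  · simp [grDim_of_four_le hm4 (p := i + 4) (by omega)]

end Main

theorem mainTheorem3 {R : Type u} [CommRing R] [IsLocalRing R] [IsNoetherianRing R]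
    (hm4 : maximalIdeal R ^ 4 = ⊥) (hm3 : maximalIdeal R ^ 3 ≠ ⊥) :
    (∀ (M N : Type u) [AddCommGroup M] [Module R M] [Module.Finite R M]
        [AddCommGroup N] [Module R N] [Module.Finite R N]
        (F : MinimalFreeResolution R M) (G : MinimalFreeResolution R N),
        F.EventuallyLinear → G.EventuallyLinear →
        HasPolynomialGrowth F.rank → HasExponentialGrowth G.rank →
        (∀ᶠ i : ℕ in atTop, ExtToRingVanishes R N i) →
        ∃ e : ℕ, hilbertSeries R =
          1 + (e : PowerSeries ℤ) * PowerSeries.X + (e : PowerSeries ℤ) * PowerSeries.X ^ 2 +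
            PowerSeries.X ^ 3) ∧
    (∀ (M : Type u) [AddCommGroup M] [Module R M]
        (F : MinimalFreeResolution R M) (G : MinimalFreeResolution R (Module.Dual R M)),
        IsTotallyReflexive R M →
        F.EventuallyLinear → G.EventuallyLinear →
        HasPolynomialGrowth F.rank → HasExponentialGrowth G.rank →
        ∃ e : ℕ, hilbertSeries R =
          1 + (e : PowerSeries ℤ) * PowerSeries.X + (e : PowerSeries ℤ) * PowerSeries.X ^ 2 +
            PowerSeries.X ^ 3) := by
  refine ⟨fun M N _ _ _ _ _ _ F G hF hG hM hN hExt => ?_, fun M _ _ F G hT hF hG hM hN => ?_⟩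
  · exact hilbertSeries_eq_of_grDim_eq hm4 (grDim_eq_of_resolutions hm4 hm3 F G hF hG hM hN hExt)
  · refine hilbertSeries_eq_of_grDim_eq hm4 (grDim_eq_of_resolutions hm4 hm3 F G hF hG hM hN ?_)
    filter_upwards [eventually_gt_atTop 0] with i hi using hT.ext_dual_vanishes i hi
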